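/- Let $\boldsymbol{k}=\mathbb{R}$ or $\mathbb{C}$, let $n,k\ge 0$ and $m\ge 1$ be integers, and let $S=\boldsymbol{k}[x_1,\dots,x_n]$. A Nambu-Poisson bracket of arity $m$ on a commutative $\boldsymbol{k}$-algebra $A$ is a $\boldsymbol{k}$-multilinear antisymmetric map $\{\,,\dots,\,\}:A^m\to A$ such that for all $a_1,\dots,a_{m-1},b_1,\dots,b_m,a,b\in A$ $$\{a_1,\dots,a_{m-1},ab\}=a\{a_1,\dots,a_{m-1},b\}+b\{a_1,\dots,a_{m-1},a\},$$ $$\{a_1,\dots,a_{m-1},\{b_1,\dots,b_m\}\}=\sum_{l=1}^m\{b_1,\dots,b_{l-1},\{a_1,\dots,a_{m-1},b_l\},b_{l+1},\dots,b_m\}.$$ Let $X^1,\dots,X^{k+m}$ be pairwise commuting $\boldsymbol{k}$-linear derivations of $S$, and let $g,f_1,\dots,f_k\in S$. For $a_1,\dots,a_m\in S$ put $f_{k+i}:=a_i$ $(1\le i\le m)$ and $$\{a_1,\dots,a_m\}:=g\,\operatorname{Det}\bigl(X^\nu(f_\mu)\bigr)_{\mu,\nu=1,\dots,k+m}.$$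 Then: 1. $\{\,,\dots,\,\}$ is a Nambu-Poisson bracket of arity $m$ on $S$. 2. $f_1,\dots,f_k$ are Casimirs: $\{a_1,\dots,a_{m-1},f_\mu\}=0$ for all $a_1,\dots,a_{m-1}\in S$ and $1\le\mu\le k$. 3. The ideal $I=(f_1,\dots,f_k)$ is a Nambu-Poisson ideal, i.e. $\{I,S,\dots,S\}\subseteq I$, and there is a unique Nambu-Poisson bracket of arity $m$ on $S/I$ with $\{s_1+I,\dots,s_m+I\}=\{s_1,\dots,s_m\}+I$ for all $s_1,\dots,s_m\in S$. Thus $S/I$ is a Nambu-Poisson algebra. -/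

import Mathlib

/-- A Nambu-Poisson bracket of arity `m = p + 1` (so `m ≥ 1`) on a commutative `𝕜`-algebra `A`:
a `𝕜`-multilinear antisymmetric map satisfying the Leibniz rule in the last argument and the
fundamental (Filippov) identity. Here `Fin.snoc a x` is the tuple `(a₁, …, a_{m-1}, x)`. -/
structure IsNambuPoissonBracket (𝕜 : Type*) {A : Type*} [CommRing 𝕜] [CommRing A] [Algebra 𝕜 A]
    {p : ℕ} (B : (Fin (p + 1) → A) → A) : Prop where
  map_update_add : ∀ (a : Fin (p + 1) → A) (i : Fin (p + 1)) (x y : A),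
    B (Function.update a i (x + y)) = B (Function.update a i x) + B (Function.update a i y)
  map_update_smul : ∀ (a : Fin (p + 1) → A) (i : Fin (p + 1)) (c : 𝕜) (x : A),
    B (Function.update a i (c • x)) = c • B (Function.update a i x)
  antisymm : ∀ (a : Fin (p + 1) → A) (σ : Equiv.Perm (Fin (p + 1))),
    B (fun i => a (σ i)) = (Equiv.Perm.sign σ : ℤ) • B a
  leibniz : ∀ (a : Fin p → A) (x y : A),
    B (Fin.snoc (α := fun _ => A) a (x * y)) =
      x * B (Fin.snoc (α := fun _ => A) a y) + y * B (Fin.snoc (α := fun _ => A) a x)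
  fundamental : ∀ (a : Fin p → A) (b : Fin (p + 1) → A),
    B (Fin.snoc (α := fun _ => A) a (B b)) =
      ∑ l, B (Function.update b l (B (Fin.snoc (α := fun _ => A) a (b l))))

/-- `f` is a Casimir of the bracket `B`: `{a₁, …, a_{m-1}, f} = 0` for all `a₁, …, a_{m-1}`. -/
def IsCasimir {A : Type*} [CommRing A] {p : ℕ} (B : (Fin (p + 1) → A) → A) (f : A) : Prop :=
  ∀ a : Fin p → A, B (Fin.snoc (α := fun _ => A) a f) = 0

/-- `I` is a Nambu-Poisson ideal for the bracket `B`: `{I, A, …, A} ⊆ I`. -/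
def IsNambuPoissonIdeal {A : Type*} [CommRing A] {p : ℕ} (B : (Fin (p + 1) → A) → A)
    (I : Ideal A) : Prop :=
  ∀ a : Fin (p + 1) → A, a 0 ∈ I → B a ∈ I

/-- The determinantal bracket `{a₁, …, aₘ} = g · Det (X^ν (f_μ))_{μ,ν = 1, …, k + m}`, where
`f_{k+i} = aᵢ` for `i = 1, …, m`. -/
def detBracket {𝕜 A : Type*} [CommRing 𝕜] [CommRing A] [Algebra 𝕜 A] {k m : ℕ}
    (X : Fin (k + m) → Derivation 𝕜 A A) (g : A) (f : Fin k → A) (a : Fin m → A) : A :=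
  g * (Matrix.of fun μ ν : Fin (k + m) => X ν (Fin.append f a μ)).det

open Function Matrix

section Determinant

variable {𝕜 A ι : Type*} [CommRing 𝕜] [CommRing A] [Algebra 𝕜 A] [DecidableEq ι]

/-! With all entries but one fixed, the bracket is a derivation `D = ∑ v^ν X^ν`, where `v^ν` is `g`
times a cofactor. As the `X^ν` commute, `D` fails to commute with them only through `K = (X^ν v^l)`,
so the sum over rows exceeds `D det` by `tr K · det` (`sum_det_updateRow_mul`). Cofactors are
divergence free (`sum_map_adjugate_jacobianMatrix`), hence `g · tr K = D g`: the excess, times `g`,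
is the Leibniz term `D g · det`. This proves the fundamental identity on all `k + m` rows; the rows
of `f` drop out because `D f_μ = 0`. -/

theorem Derivation.map_finset_prod (D : Derivation 𝕜 A A) (s : Finset ι) (f : ι → A) :
    D (∏ i ∈ s, f i) = ∑ i ∈ s, ∏ j ∈ s, update f i (D (f i)) j := by
  induction s using Finset.induction_on with
  | empty => simp
  | insert a s ha ih =>
    rw [Finset.prod_insert ha, D.leibniz, ih, Finset.sum_insert ha, Finset.prod_insert ha, add_comm]
    simp only [smul_eq_mul, update_self]
    congr 1
    · rw [mul_comm]
      congr 1
      refine Finset.prod_congr rfl fun j hj => ?_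
      rw [update_of_ne (ne_of_mem_of_not_mem hj ha)]
    · rw [Finset.mul_sum]
      refine Finset.sum_congr rfl fun i hi => ?_
      rw [Finset.prod_insert ha, update_of_ne (ne_of_mem_of_not_mem hi ha).symm]

variable [Fintype ι]

/-- A derivation acts on a determinant row by row. -/
theorem Derivation.map_det (D : Derivation 𝕜 A A) (M : Matrix ι ι A) :
    D M.det = ∑ i, (M.updateRow i fun j => D (M i j)).det := by
  simp only [← det_transpose M, ← det_transpose (updateRow _ _ _), det_apply', transpose_apply]
  rw [map_sum, Finset.sum_comm]
  refine Finset.sum_congr rfl fun σ _ => ?_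
  rw [← Finset.mul_sum, D.leibniz, D.map_intCast, smul_zero, add_zero, D.map_finset_prod,
    smul_eq_mul]
  congr 1
  refine Finset.sum_congr rfl fun i _ => Finset.prod_congr rfl fun j _ => ?_
  rcases eq_or_ne j i with rfl | h
  · simp
  · simp [h]

theorem Matrix.det_updateRow_eq_sum (M : Matrix ι ι A) (i : ι) (r : ι → A) :
    (M.updateRow i r).det = ∑ j, M.adjugate j i * r j := by
  rw [← cramer_transpose_apply, cramer_eq_adjugate_mulVec, ← adjugate_transpose]
  rfl

/-- First-order term of `det (M (1 + t K))` in `t`. -/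
theorem Matrix.sum_det_updateRow_mul (M K : Matrix ι ι A) :
    ∑ i, (M.updateRow i ((M * K) i)).det = K.trace * M.det := by
  have h : ∑ i, (M.updateRow i ((M * K) i)).det = (M * K * M.adjugate).trace := by
    simp only [det_updateRow_eq_sum, trace, Matrix.diag_apply, mul_apply (M := M * K)]
    exact Finset.sum_congr rfl fun i _ => Finset.sum_congr rfl fun j _ => mul_comm _ _
  rw [h, trace_mul_comm, ← Matrix.mul_assoc, adjugate_mul, smul_mul, Matrix.one_mul, trace_smul,
    smul_eq_mul, mul_comm]

theorem Matrix.det_updateRow_updateRow_swap (M : Matrix ι ι A) {i j : ι} (h : i ≠ j)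
    (r s : ι → A) :
    ((M.updateRow i r).updateRow j s).det = -((M.updateRow i s).updateRow j r).det := by
  have h1 := detRowAlternating.map_swap ((M.updateRow i s).updateRow j r : ι → ι → A) h
  refine Eq.trans (congrArg detRowAlternating ?_) h1
  funext l
  change _ = (M.updateRow i s).updateRow j r (Equiv.swap i j l)
  rcases eq_or_ne l i with rfl | hl
  · rw [Equiv.swap_apply_left, updateRow_ne h, updateRow_self, updateRow_self]
  · rcases eq_or_ne l j with rfl | hl'
    · rw [Equiv.swap_apply_right, updateRow_ne h, updateRow_self, updateRow_self]
    · rw [Equiv.swap_apply_of_ne_of_ne hl hl', updateRow_ne hl', updateRow_ne hl, updateRow_ne hl',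
        updateRow_ne hl]

theorem Matrix.det_updateRow_updateRow_self (M : Matrix ι ι A) {i j : ι} (h : i ≠ j)
    (r : ι → A) : ((M.updateRow i r).updateRow j r).det = 0 := by
  refine det_zero_of_row_eq h ?_
  rw [updateRow_ne h, updateRow_self, updateRow_self]

end Determinant

/-! ### Jacobian determinants of commuting derivations. -/

section Jacobian

variable {𝕜 A ι : Type*} [CommRing 𝕜] [CommRing A] [Algebra 𝕜 A]

/-- The Jacobian matrix `X^ν (b_μ)`. -/
def jacobianMatrix (X : ι → Derivation 𝕜 A A) (b : ι → A) : Matrix ι ι A :=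
  Matrix.of fun μ ν => X ν (b μ)

@[simp]
theorem jacobianMatrix_apply (X : ι → Derivation 𝕜 A A) (b : ι → A) (μ ν : ι) :
    jacobianMatrix X b μ ν = X ν (b μ) := rfl

variable [DecidableEq ι]

theorem jacobianMatrix_update (X : ι → Derivation 𝕜 A A) (b : ι → A) (i : ι) (x : A) :
    jacobianMatrix X (update b i x) = (jacobianMatrix X b).updateRow i fun ν => X ν x := by
  ext μ ν
  rcases eq_or_ne μ i with rfl | h
  · simp
  · simp [h]

variable [Fintype ι]

/-- The cofactors of a row of the Jacobian matrix of commuting derivations are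
divergence free. -/
theorem sum_map_adjugate_jacobianMatrix {X : ι → Derivation 𝕜 A A} (hX : ∀ i j, ⁅X i, X j⁆ = 0)
    (b : ι → A) (i : ι) : ∑ ν, X ν ((jacobianMatrix X b).adjugate ν i) = 0 := by
  simp only [adjugate_apply, Derivation.map_det]
  rw [Finset.sum_comm]
  refine Finset.sum_eq_zero fun μ _ => ?_
  -- Row `i` is a constant unit vector, so differentiating it leaves a zero row.
  rcases eq_or_ne i μ with rfl | h
  · refine Finset.sum_eq_zero fun ν _ => det_eq_zero_of_row_eq_zero i fun j => ?_
    rcases eq_or_ne j ν with rfl | hj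
    · simp
    · simp [hj]
  · simp only [updateRow_ne h.symm, jacobianMatrix_apply]
    simp only [det_updateRow_eq_sum _ μ]
    simp only [adjugate_apply]
    rw [← Finset.sum_product' (s := Finset.univ) (t := Finset.univ) (f := fun ν l =>
      (((jacobianMatrix X b).updateRow i (Pi.single ν 1)).updateRow μ (Pi.single l 1)).det *
        X ν (X l (b μ)))]
    -- Second derivatives are symmetric in `(ν, l)`, double cofactors antisymmetric; diagonal terms
    -- have two equal rows.
    refine Finset.sum_involution (fun q _ => q.swap) ?_ ?_ ?_ ?_
    · rintro ⟨ν, l⟩ -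
      have hc : X ν (X l (b μ)) = X l (X ν (b μ)) := by
        have := DFunLike.congr_fun (hX ν l) (b μ)
        rwa [Derivation.commutator_apply, Derivation.zero_apply, sub_eq_zero] at this
      simp only [Prod.swap]
      rw [det_updateRow_updateRow_swap _ h, hc]
      ring
    · rintro ⟨ν, l⟩ - h0 hs
      obtain rfl : l = ν := congrArg Prod.fst hs
      exact h0 (by simp only [det_updateRow_updateRow_self _ h, zero_mul])
    · simp
    · simp

/-- The derivation `x ↦ g · Det (X^ν (b_μ))` where `x` is put in place of `b_i`. -/
def jacobianDerivation (X : ι → Derivation 𝕜 A A) (g : A) (b : ι → A) (i : ι) :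
    Derivation 𝕜 A A :=
  ∑ ν, (g * (jacobianMatrix X b).adjugate ν i) • X ν

theorem jacobianDerivation_eq_sum (X : ι → Derivation 𝕜 A A) (g : A) (b : ι → A) (i : ι)
    (x : A) : jacobianDerivation X g b i x =
      ∑ ν, g * (jacobianMatrix X b).adjugate ν i * X ν x := by
  rw [jacobianDerivation, ← Derivation.coeFnAddMonoidHom_apply, map_sum, Finset.sum_apply]
  rfl

theorem jacobianDerivation_apply (X : ι → Derivation 𝕜 A A) (g : A) (b : ι → A) (i : ι) (x : A) :
    jacobianDerivation X g b i x = g * (jacobianMatrix X (update b i x)).det := by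
  rw [jacobianDerivation_eq_sum, jacobianMatrix_update, det_updateRow_eq_sum, Finset.mul_sum]
  exact Finset.sum_congr rfl fun ν _ => mul_assoc _ _ _

/-- The fundamental identity for the bracket `g · Det (X^ν (b_μ))` of full arity. -/
theorem jacobianDerivation_map_det {X : ι → Derivation 𝕜 A A} (hX : ∀ i j, ⁅X i, X j⁆ = 0)
    (g : A) (h : ι → A) (i : ι) (b : ι → A) :
    jacobianDerivation X g h i (g * (jacobianMatrix X b).det) =
      ∑ μ, g * (jacobianMatrix X (update b μ (jacobianDerivation X g h i (b μ)))).det := by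
  set D := jacobianDerivation X g h i with hD
  set v : ι → A := fun ν => g * (jacobianMatrix X h).adjugate ν i with hv
  have hDv : ∀ x, D x = ∑ ν, v ν * X ν x := jacobianDerivation_eq_sum X g h i
  set K : Matrix ι ι A := Matrix.of fun l ν => X ν (v l) with hK
  have hcomm : ∀ i j x, X i (X j x) = X j (X i x) := fun i j x => by
    have := DFunLike.congr_fun (hX i j) x
    rwa [Derivation.commutator_apply, Derivation.zero_apply, sub_eq_zero] at this
  have htr : g * K.trace = D g := by
    have h0 := sum_map_adjugate_jacobianMatrix hX h i
    simp only [trace, Matrix.diag_apply, hK, of_apply, hv, Derivation.leibniz, smul_eq_mul,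
      Finset.sum_add_distrib, ← Finset.mul_sum]
    rw [h0, mul_zero, zero_add, hDv, Finset.mul_sum]
    refine Finset.sum_congr rfl fun ν _ => ?_
    simp only [hv]
    ring
  have hrow : ∀ μ, (fun ν => X ν (D (b μ))) =
      (fun ν => D (jacobianMatrix X b μ ν)) + (jacobianMatrix X b * K) μ := by
    intro μ
    ext ν
    simp only [Pi.add_apply, mul_apply, jacobianMatrix_apply, hK, of_apply, hDv, map_sum,
      Derivation.leibniz, smul_eq_mul, Finset.sum_add_distrib, hcomm ν]
  have hsum : ∑ μ, (jacobianMatrix X (update b μ (D (b μ)))).det =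
      D (jacobianMatrix X b).det + K.trace * (jacobianMatrix X b).det := by
    simp only [jacobianMatrix_update, hrow, det_updateRow_add, Finset.sum_add_distrib,
      sum_det_updateRow_mul, Derivation.map_det D]
  rw [← Finset.mul_sum, hsum, Derivation.leibniz, mul_add, ← mul_assoc, htr, smul_eq_mul,
    smul_eq_mul, mul_comm (D g)]

end Jacobian

/-! ### The bracket with `f` frozen in the first `k` rows. -/

section DetBracket

theorem Fin.castAdd_ne_natAdd {k m : ℕ} (i : Fin k) (j : Fin m) :
    Fin.castAdd m i ≠ Fin.natAdd k j := by
  simp only [ne_eq, Fin.ext_iff, Fin.val_castAdd, Fin.val_natAdd]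
  omega

theorem Fin.append_update_right {α : Type*} {k m : ℕ} (f : Fin k → α) (a : Fin m → α) (i : Fin m)
    (x : α) : Fin.append f (update a i x) = update (Fin.append f a) (Fin.natAdd k i) x := by
  ext j
  refine Fin.addCases (fun j => ?_) (fun j => ?_) j
  · rw [Fin.append_left, update_of_ne (Fin.castAdd_ne_natAdd j i), Fin.append_left]
  · rcases eq_or_ne j i with rfl | h
    · simp
    · rw [Fin.append_right, update_of_ne h, update_of_ne (by simpa using h), Fin.append_right]

variable {𝕜 A : Type*} [CommRing 𝕜] [CommRing A] [Algebra 𝕜 A] {k m p : ℕ}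

theorem detBracket_eq (X : Fin (k + m) → Derivation 𝕜 A A) (g : A) (f : Fin k → A)
    (a : Fin m → A) : detBracket X g f a = g * (jacobianMatrix X (Fin.append f a)).det := rfl

theorem detBracket_update (X : Fin (k + m) → Derivation 𝕜 A A) (g : A) (f : Fin k → A)
    (a : Fin m → A) (i : Fin m) (x : A) :
    detBracket X g f (update a i x) =
      jacobianDerivation X g (Fin.append f a) (Fin.natAdd k i) x := by
  rw [detBracket_eq, Fin.append_update_right, jacobianDerivation_apply]

/-- The `0` is a placeholder: its row is overwritten by `x`. -/
theorem detBracket_snoc (X : Fin (k + (p + 1)) → Derivation 𝕜 A A) (g : A) (f : Fin k → A)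
    (a : Fin p → A) (x : A) :
    detBracket X g f (Fin.snoc (α := fun _ => A) a x) =
      jacobianDerivation X g (Fin.append f (Fin.snoc (α := fun _ => A) a 0))
        (Fin.natAdd k (Fin.last p)) x := by
  rw [← detBracket_update, Fin.update_snoc_last]

/-- The row of `f μ` occurs twice. -/
theorem jacobianDerivation_append_left (X : Fin (k + m) → Derivation 𝕜 A A) (g : A)
    (f : Fin k → A) (a : Fin m → A) (i : Fin m) (μ : Fin k) :
    jacobianDerivation X g (Fin.append f a) (Fin.natAdd k i) (f μ) = 0 := by
  have h := Fin.castAdd_ne_natAdd μ i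
  rw [jacobianDerivation_apply, det_zero_of_row_eq h, mul_zero]
  ext ν
  simp [h]

theorem detBracket_comp_perm (X : Fin (k + m) → Derivation 𝕜 A A) (g : A) (f : Fin k → A)
    (a : Fin m → A) (σ : Equiv.Perm (Fin m)) :
    detBracket X g f (fun i => a (σ i)) = (Equiv.Perm.sign σ : ℤ) • detBracket X g f a := by
  set τ : Equiv.Perm (Fin (k + m)) :=
    finSumFinEquiv.permCongr (Equiv.Perm.sumCongr (Equiv.refl (Fin k)) σ) with hτ
  have hsign : Equiv.Perm.sign τ = Equiv.Perm.sign σ := by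
    rw [hτ, Equiv.Perm.sign_permCongr, Equiv.Perm.sign_sumCongr, Equiv.Perm.sign_refl, one_mul]
  have hM : jacobianMatrix X (Fin.append f fun i => a (σ i)) =
      (jacobianMatrix X (Fin.append f a)).submatrix τ id := by
    ext μ ν
    refine Fin.addCases (fun j => ?_) (fun j => ?_) μ <;> simp [hτ, Equiv.permCongr_apply]
  rw [detBracket_eq, hM, det_permute, hsign, detBracket_eq, zsmul_eq_mul]
  ring

theorem isNambuPoissonBracket_detBracket {X : Fin (k + (p + 1)) → Derivation 𝕜 A A}
    (hX : ∀ i j, ⁅X i, X j⁆ = 0) (g : A) (f : Fin k → A) :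
    IsNambuPoissonBracket 𝕜 (detBracket X g f) where
  map_update_add a i x y := by simp only [detBracket_update, map_add]
  map_update_smul a i c x := by simp only [detBracket_update, Derivation.map_smul]
  antisymm a σ := detBracket_comp_perm X g f a σ
  leibniz a x y := by simp only [detBracket_snoc, Derivation.leibniz, smul_eq_mul]
  fundamental a b := by
    simp only [detBracket_snoc]
    rw [detBracket_eq, jacobianDerivation_map_det hX, Fin.sum_univ_add]
    simp only [Fin.append_left, Fin.append_right, jacobianDerivation_append_left,
      ← Fin.append_update_right, ← detBracket_eq]
    rw [add_eq_right]
    refine Finset.sum_eq_zero fun μ _ => ?_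
    rw [← jacobianDerivation_apply, map_zero]

theorem isCasimir_detBracket (X : Fin (k + (p + 1)) → Derivation 𝕜 A A) (g : A) (f : Fin k → A)
    (μ : Fin k) : IsCasimir (detBracket X g f) (f μ) := fun a => by
  rw [detBracket_snoc, jacobianDerivation_append_left]

/-- A derivation killing the generators of an ideal preserves it. Every slot `i` is covered, as the
descent to the quotient needs. -/
theorem detBracket_mem_span (X : Fin (k + m) → Derivation 𝕜 A A) (g : A) (f : Fin k → A)
    (a : Fin m → A) (i : Fin m) (h : a i ∈ Ideal.span (Set.range f)) :
    detBracket X g f a ∈ Ideal.span (Set.range f) := by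
  rw [← update_eq_self i a, detBracket_update]
  generalize a i = x at h
  induction h using Submodule.span_induction with
  | mem x hx =>
    obtain ⟨μ, rfl⟩ := hx
    rw [jacobianDerivation_append_left]
    exact zero_mem _
  | zero => rw [map_zero]; exact zero_mem _
  | add x y _ _ hx hy => rw [map_add]; exact add_mem hx hy
  | smul r x hx ih =>
    rw [smul_eq_mul, Derivation.leibniz]
    exact add_mem (Ideal.mul_mem_left _ _ ih) (Ideal.mul_mem_right _ _ hx)

end DetBracket

/-! ### Descent to the quotient algebra. -/

section Quotient

variable {𝕜 A : Type*} [CommRing 𝕜] [CommRing A] [Algebra 𝕜 A] {p : ℕ}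
  {B : (Fin (p + 1) → A) → A} {I : Ideal A}

theorem IsNambuPoissonBracket.update_sub_mem (hB : IsNambuPoissonBracket 𝕜 B)
    (hI : ∀ a i, a i ∈ I → B a ∈ I) (a : Fin (p + 1) → A) (i : Fin (p + 1)) {x : A}
    (h : x - a i ∈ I) : B (update a i x) - B a ∈ I := by
  have h1 := hB.map_update_add a i (x - a i) (a i)
  rw [sub_add_cancel, update_eq_self] at h1
  rw [h1, add_sub_cancel_right]
  exact hI _ i (by rwa [update_self])

theorem IsNambuPoissonBracket.mk_eq_mk (hB : IsNambuPoissonBracket 𝕜 B)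
    (hI : ∀ a i, a i ∈ I → B a ∈ I) {a b : Fin (p + 1) → A}
    (h : ∀ i, Ideal.Quotient.mk I (a i) = Ideal.Quotient.mk I (b i)) :
    Ideal.Quotient.mk I (B a) = Ideal.Quotient.mk I (B b) := by
  -- Replace the entries of `b` by those of `a` one at a time.
  have key : ∀ s : Finset (Fin (p + 1)),
      Ideal.Quotient.mk I (B (s.piecewise a b)) = Ideal.Quotient.mk I (B b) := by
    intro s
    induction s using Finset.induction_on with
    | empty => simp
    | insert i s hi ih =>
      rw [Finset.piecewise_insert, ← ih, Ideal.Quotient.eq]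
      refine hB.update_sub_mem hI _ i ?_
      rw [Finset.piecewise_eq_of_notMem _ _ _ hi, ← Ideal.Quotient.eq]
      exact h i
  simpa using key Finset.univ

/-- A Nambu-Poisson bracket descends uniquely to the quotient by an ideal which absorbs it in
every argument. -/
theorem IsNambuPoissonBracket.existsUnique_quotient (hB : IsNambuPoissonBracket 𝕜 B)
    (hI : ∀ a i, a i ∈ I → B a ∈ I) :
    ∃! C : (Fin (p + 1) → A ⧸ I) → A ⧸ I, IsNambuPoissonBracket 𝕜 C ∧
      ∀ a : Fin (p + 1) → A,
        C (fun i => Ideal.Quotient.mk I (a i)) = Ideal.Quotient.mk I (B a) := by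
  have hs : Surjective (Ideal.Quotient.mk I) := Ideal.Quotient.mk_surjective
  -- The choice of lifts is immaterial by `mk_eq_mk`, so each axiom can be checked on arbitrary
  -- representatives.
  set C : (Fin (p + 1) → A ⧸ I) → A ⧸ I :=
    fun q => Ideal.Quotient.mk I (B fun i => surjInv hs (q i)) with hC
  have hCB : ∀ a : Fin (p + 1) → A,
      C (Ideal.Quotient.mk I ∘ a) = Ideal.Quotient.mk I (B a) := fun a =>
    hB.mk_eq_mk hI fun i => surjInv_eq hs _
  have hu : ∀ (a : Fin (p + 1) → A) (i : Fin (p + 1)) (x : A),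
      C (update (Ideal.Quotient.mk I ∘ a) i (Ideal.Quotient.mk I x)) =
        Ideal.Quotient.mk I (B (update a i x)) := fun a i x => by
    rw [← comp_update, hCB]
  have hn : ∀ (a : Fin p → A) (x : A),
      C (Fin.snoc (α := fun _ => A ⧸ I) (Ideal.Quotient.mk I ∘ a) (Ideal.Quotient.mk I x)) =
        Ideal.Quotient.mk I (B (Fin.snoc (α := fun _ => A) a x)) := fun a x => by
    rw [← Fin.comp_snoc, hCB]
  have hsmul : ∀ (c : 𝕜) (x : A),
      c • Ideal.Quotient.mk I x = Ideal.Quotient.mk I (c • x) := fun _ _ => rfl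
  refine ⟨C, ⟨⟨?_, ?_, ?_, ?_, ?_⟩, hCB⟩, ?_⟩
  · intro q i x y
    obtain ⟨a, rfl⟩ := hs.comp_left q
    obtain ⟨x, rfl⟩ := hs x
    obtain ⟨y, rfl⟩ := hs y
    rw [← map_add, hu, hu, hu, hB.map_update_add, map_add]
  · intro q i c x
    obtain ⟨a, rfl⟩ := hs.comp_left q
    obtain ⟨x, rfl⟩ := hs x
    rw [hsmul, hu, hu, hB.map_update_smul, hsmul]
  · intro q σ
    obtain ⟨a, rfl⟩ := hs.comp_left q
    rw [hCB, ← map_zsmul, ← hB.antisymm]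
    exact hCB fun i => a (σ i)
  · intro q x y
    obtain ⟨a, rfl⟩ := hs.comp_left q
    obtain ⟨x, rfl⟩ := hs x
    obtain ⟨y, rfl⟩ := hs y
    rw [← map_mul, hn, hn, hn, hB.leibniz, map_add, map_mul, map_mul]
  · intro q r
    obtain ⟨a, rfl⟩ := hs.comp_left q
    obtain ⟨b, rfl⟩ := hs.comp_left r
    simp only [hCB, hn, Function.comp_apply, hu]
    rw [hB.fundamental, map_sum]
  · rintro C' ⟨-, hC'⟩
    funext q
    obtain ⟨a, rfl⟩ := hs.comp_left q
    rw [hCB]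
    exact hC' a

end Quotient

theorem theorem2p4 {𝕜 : Type*} [RCLike 𝕜] (n k p : ℕ)
    (X : Fin (k + (p + 1)) → Derivation 𝕜 (MvPolynomial (Fin n) 𝕜) (MvPolynomial (Fin n) 𝕜))
    (hX : ∀ i j, ⁅X i, X j⁆ = 0)
    (g : MvPolynomial (Fin n) 𝕜) (f : Fin k → MvPolynomial (Fin n) 𝕜) :
    IsNambuPoissonBracket 𝕜 (detBracket X g f) ∧
    (∀ μ : Fin k, IsCasimir (detBracket X g f) (f μ)) ∧
    IsNambuPoissonIdeal (detBracket X g f) (Ideal.span (Set.range f)) ∧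
    ∃! B : (Fin (p + 1) → MvPolynomial (Fin n) 𝕜 ⧸ Ideal.span (Set.range f)) →
        MvPolynomial (Fin n) 𝕜 ⧸ Ideal.span (Set.range f),
      IsNambuPoissonBracket 𝕜 B ∧
      ∀ a : Fin (p + 1) → MvPolynomial (Fin n) 𝕜,
        B (fun i => Ideal.Quotient.mk (Ideal.span (Set.range f)) (a i)) =
          Ideal.Quotient.mk (Ideal.span (Set.range f)) (detBracket X g f a) :=
  ⟨isNambuPoissonBracket_detBracket hX g f, isCasimir_detBracket X g f,
    fun a h => detBracket_mem_span X g f a 0 h,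
    (isNambuPoissonBracket_detBracket hX g f).existsUnique_quotient
      (detBracket_mem_span X g f)⟩
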